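/- Let $M$ be a connected smooth (Hausdorff) manifold of dimension $n$, and let $\nabla$ be a smooth linear connection on $M$, i.e. a covariant derivative on $TM$, not necessarily torsion-free. A semi-Riemannian metric on $M$ is a smooth field of nondegenerate symmetric bilinear forms on the tangent spaces, of any signature; it is parallel if $\nabla g=0$, i.e. $X(g(Y,Z))=g(\nabla_XY,Z)+g(Y,\nabla_XZ)$ for all vector fields $X,Y,Z$. Metrics $g_1,\dots,g_k$ are called independent if they are linearly independent over $\mathbb{R}$ as tensor fields on $M$. For $x\in M$ the holonomy group $\Psi(x)$ is the group of linear automorphisms of $T_xM$ given by parallel translation along piecewise $C^1$ loops at $x$. The connection has reducible holonomy if, for some (equivalently, every) $x\in M$, there is a linear subspace $W$ with $0\neq W\neq T_xM$ and $\psi(W)\subseteq W$ for all $\psi\in\Psi(x)$. Then $\nabla$ has reducible holonomy in each of the following cases: (i) there are two independent semi-Riemannian metrics $g_1,g_2$ on $M$, parallel with respect to $\nabla$, one of which has signature $(p,q)$ with $p\neq q$; (ii) $n=2$ and there are two independent semi-Riemannian metrics on $M$, parallel with respect to $\nabla$; (iii) $n\not\equiv 0 \pmod 4$ and there are three independent semi-Riemannian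 metrics on $M$, parallel with respect to $\nabla$; (iv) there are four independent semi-Riemannian metrics on $M$, parallel with respect to $\nabla$. -/

import Mathlib

open Set Bundle
open scoped Manifold ContDiff

noncomputable section

/-- A semi-Riemannian metric on an `n`-dimensional smooth manifold `M`: a smooth field of
symmetric nondegenerate bilinear forms on the tangent spaces. (Of any signature, definite or not.
On a connected manifold the signature is automatically constant.) -/
structure SemiRiemannianMetric (n : ℕ) (M : Type*) [TopologicalSpace M]
    [ChartedSpace (EuclideanSpace ℝ (Fin n)) M] [IsManifold (𝓡 n) ∞ M] where
  /-- The bilinear form on the tangent space at `x`. -/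
  toFun (x : M) : TangentSpace (𝓡 n) x →L[ℝ] TangentSpace (𝓡 n) x →L[ℝ] ℝ
  symm (x : M) (v w : TangentSpace (𝓡 n) x) : toFun x v w = toFun x w v
  nondegenerate (x : M) (v : TangentSpace (𝓡 n) x) (hv : ∀ w, toFun x v w = 0) : v = 0
  smooth : ContMDiff (𝓡 n)
    ((𝓡 n).prod 𝓘(ℝ, EuclideanSpace ℝ (Fin n) →L[ℝ] EuclideanSpace ℝ (Fin n) →L[ℝ] ℝ)) ∞
    (fun x ↦ TotalSpace.mk' (EuclideanSpace ℝ (Fin n) →L[ℝ] EuclideanSpace ℝ (Fin n) →L[ℝ] ℝ)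
      (E := fun x : M ↦ TangentSpace (𝓡 n) x →L[ℝ] TangentSpace (𝓡 n) x →L[ℝ] ℝ) x (toFun x))

/-- A (smooth) linear connection on `M`, that is, a smooth covariant derivative on the tangent
bundle; it may have torsion. In Mathlib's argument order, `cov Y x (X x)` is `(∇_X Y)(x)`. -/
structure LinearConnection (n : ℕ) (M : Type*) [TopologicalSpace M]
    [ChartedSpace (EuclideanSpace ℝ (Fin n)) M] [IsManifold (𝓡 n) ∞ M] where
  /-- The underlying covariant derivative. -/
  cov : CovariantDerivative (𝓡 n) (EuclideanSpace ℝ (Fin n))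
    (fun x : M ↦ TangentSpace (𝓡 n) x)
  smooth : cov.ContMDiffCovariantDerivative ∞

section

variable {n : ℕ} {M : Type*} [TopologicalSpace M]
  [ChartedSpace (EuclideanSpace ℝ (Fin n)) M] [IsManifold (𝓡 n) ∞ M]

namespace SemiRiemannianMetric

/-- The quadratic form `v ↦ g(v, v)` on the tangent space at `x`. -/
def quadraticForm (g : SemiRiemannianMetric n M) (x : M) :
    QuadraticForm ℝ (TangentSpace (𝓡 n) x) :=
  LinearMap.BilinMap.toQuadraticMap (g.toFun x).toLinearMap₁₂

/-- The metric has signature `(p, q)`: at each point, `p` is the maximal dimension of a positive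
definite subspace and `q` the maximal dimension of a negative definite subspace. -/
def HasSignature (g : SemiRiemannianMetric n M) (p q : ℕ) : Prop :=
  ∀ x : M, sigPos (g.quadraticForm x) = p ∧ sigNeg (g.quadraticForm x) = q

/-- The metric `g` is parallel, `∇ g = 0`: for every point `x`, every tangent vector `X` at `x` and
all vector fields `Y`, `Z` that are differentiable at `x`,
`X (g(Y, Z)) = g(∇_X Y, Z) + g(Y, ∇_X Z)`. -/
def IsParallel (g : SemiRiemannianMetric n M) (D : LinearConnection n M) : Prop :=
  ∀ (x : M) (X : TangentSpace (𝓡 n) x) (Y Z : ∀ y : M, TangentSpace (𝓡 n) y),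
    MDifferentiableAt (𝓡 n) (𝓡 n).tangent (fun y ↦ (⟨y, Y y⟩ : TangentBundle (𝓡 n) M)) x →
    MDifferentiableAt (𝓡 n) (𝓡 n).tangent (fun y ↦ (⟨y, Z y⟩ : TangentBundle (𝓡 n) M)) x →
      mvfderiv (𝓡 n) (fun y ↦ g.toFun y (Y y) (Z y)) x X
        = g.toFun x (D.cov Y x X) (Z x) + g.toFun x (Y x) (D.cov Z x X)

end SemiRiemannianMetric

namespace LinearConnection

/-- Within `s`, the vector field `V` along the curve `γ` has covariant derivative `A` at time `t`.
Let `e` be the trivialization of the tangent bundle at `γ t`, with frame `E₁, …, Eₙ`, and write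
`V = ∑ vⁱ Eᵢ(γ)`. Then `DV/dt = ∑ (vⁱ)' Eᵢ + ∑ vⁱ ∇_{γ'} Eᵢ`, and at time `t` the second sum is
`∇_{γ'}` of the vector field `FiberBundle.extend _ (V t)`, which has constant coefficients
`vⁱ(t)` in the frame. -/
def HasCovDerivAlongWithinAt (D : LinearConnection n M) (γ : ℝ → M)
    (V : ∀ t : ℝ, TangentSpace (𝓡 n) (γ t)) (s : Set ℝ) (t : ℝ)
    (A : TangentSpace (𝓡 n) (γ t)) : Prop :=
  let e := trivializationAt (EuclideanSpace ℝ (Fin n)) (TangentSpace (𝓡 n) : M → Type _) (γ t)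
  let velocity : TangentSpace (𝓡 n) (γ t) := mfderivWithin 𝓘(ℝ) (𝓡 n) γ s t (1 : ℝ)
  HasDerivWithinAt (fun u ↦ (e ⟨γ u, V u⟩).2)
    (e ⟨γ t, A - D.cov (FiberBundle.extend (EuclideanSpace ℝ (Fin n)) (V t)) (γ t) velocity⟩).2 s t

/-- The linear isomorphism `τ : T_x M → T_y M` is parallel translation along the `C¹` curve
`γ : [0, 1] → M` from `x` to `y`: for each `v`, there is a vector field along `γ` with vanishing
covariant derivative, starting at `v` and ending at `τ v`. -/
def IsParallelTranslationAlong (D : LinearConnection n M) (γ : ℝ → M) (x y : M)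
    (τ : TangentSpace (𝓡 n) x ≃ₗ[ℝ] TangentSpace (𝓡 n) y) : Prop :=
  ContMDiffOn 𝓘(ℝ) (𝓡 n) 1 γ (Icc 0 1) ∧ γ 0 = x ∧ γ 1 = y ∧
    ∀ v : TangentSpace (𝓡 n) x, ∃ V : ∀ t : ℝ, TangentSpace (𝓡 n) (γ t),
      (∀ t ∈ Icc (0 : ℝ) 1, D.HasCovDerivAlongWithinAt γ V (Icc 0 1) t 0) ∧
      (⟨γ 0, V 0⟩ : TangentBundle (𝓡 n) M) = ⟨x, v⟩ ∧
      (⟨γ 1, V 1⟩ : TangentBundle (𝓡 n) M) = ⟨y, τ v⟩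

/-- `D.IsParallelTranslation x y τ` says that `τ : T_x M → T_y M` is parallel translation along
some piecewise `C¹` curve from `x` to `y`, that is, along a concatenation of finitely many `C¹`
curves. -/
inductive IsParallelTranslation (D : LinearConnection n M) :
    (x y : M) → (TangentSpace (𝓡 n) x ≃ₗ[ℝ] TangentSpace (𝓡 n) y) → Prop
  | of_curve {x y : M} {τ : TangentSpace (𝓡 n) x ≃ₗ[ℝ] TangentSpace (𝓡 n) y} (γ : ℝ → M)
      (h : D.IsParallelTranslationAlong γ x y τ) : IsParallelTranslation D x y τ
  | concat {x y z : M} {τ : TangentSpace (𝓡 n) x ≃ₗ[ℝ] TangentSpace (𝓡 n) y}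
      {τ' : TangentSpace (𝓡 n) y ≃ₗ[ℝ] TangentSpace (𝓡 n) z}
      (h : IsParallelTranslation D x y τ) (h' : IsParallelTranslation D y z τ') :
      IsParallelTranslation D x z (τ.trans τ')

theorem isParallelTranslation_refl (D : LinearConnection n M) (x : M) :
    D.IsParallelTranslation x x (LinearEquiv.refl ℝ _) := by
  refine .of_curve (fun _ ↦ x) ⟨contMDiffOn_const, rfl, rfl, fun v ↦ ⟨fun _ ↦ v, ?_, rfl, rfl⟩⟩
  intro t ht
  have h0 : mfderivWithin 𝓘(ℝ) (𝓡 n) (fun _ : ℝ ↦ x) (Icc 0 1) t = 0 := by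
    simp [mfderivWithin_const]
  unfold HasCovDerivAlongWithinAt
  simp only [h0]
  have h1 : (0 : TangentSpace (𝓡 n) x) -
      D.cov (FiberBundle.extend (EuclideanSpace ℝ (Fin n)) v) x
        ((0 : TangentSpace 𝓘(ℝ) t →L[ℝ] TangentSpace (𝓡 n) x) (1 : ℝ)) = 0 := by
    rw [zero_sub, neg_eq_zero]
    exact map_zero _
  erw [h1]
  have h2 : (trivializationAt (EuclideanSpace ℝ (Fin n)) (TangentSpace (𝓡 n) : M → Type _) x
      ⟨x, 0⟩).2 = 0 := by
    have hx : x ∈ (trivializationAt (EuclideanSpace ℝ (Fin n))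
      (TangentSpace (𝓡 n) : M → Type _) x).baseSet := FiberBundle.mem_baseSet_trivializationAt' x
    have := (trivializationAt (EuclideanSpace ℝ (Fin n))
      (TangentSpace (𝓡 n) : M → Type _) x).zeroSection ℝ hx
    exact congrArg Prod.snd this
  rw [h2]
  exact hasDerivWithinAt_const _ _ _

theorem HasCovDerivAlongWithinAt.reverse {D : LinearConnection n M} {γ : ℝ → M}
    {V : ∀ t : ℝ, TangentSpace (𝓡 n) (γ t)}
    (hγ : ContMDiffOn 𝓘(ℝ) (𝓡 n) 1 γ (Icc 0 1)) {t : ℝ} (ht : t ∈ Icc (0 : ℝ) 1)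
    (h : D.HasCovDerivAlongWithinAt γ V (Icc 0 1) (1 - t) 0) :
    D.HasCovDerivAlongWithinAt (fun u ↦ γ (1 - u)) (fun u ↦ V (1 - u)) (Icc 0 1) t 0 := by
  have ht' : 1 - t ∈ Icc (0 : ℝ) 1 := ⟨by linarith [ht.2], by linarith [ht.1]⟩
  have hmaps : MapsTo (fun u : ℝ ↦ 1 - u) (Icc 0 1) (Icc 0 1) :=
    fun u hu ↦ ⟨by linarith [hu.2], by linarith [hu.1]⟩
  have hd : HasDerivWithinAt (fun u : ℝ ↦ 1 - u) (-1) (Icc 0 1) t := by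
    simpa using (hasDerivWithinAt_id t (Icc (0 : ℝ) 1)).const_sub 1
  have hvel : mfderivWithin 𝓘(ℝ) (𝓡 n) (fun u ↦ γ (1 - u)) (Icc 0 1) t (1 : ℝ) =
      -(mfderivWithin 𝓘(ℝ) (𝓡 n) γ (Icc 0 1) (1 - t) (1 : ℝ)) := by
    have h1 : MDifferentiableWithinAt 𝓘(ℝ) (𝓡 n) γ (Icc 0 1) (1 - t) :=
      (hγ.mdifferentiableOn one_ne_zero) _ ht'
    have h2 : HasMFDerivWithinAt 𝓘(ℝ) 𝓘(ℝ) (fun u : ℝ ↦ 1 - u) (Icc 0 1) t _ :=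
      hd.hasFDerivWithinAt.hasMFDerivWithinAt
    have h3 := (h1.hasMFDerivWithinAt.comp t h2 hmaps).mfderivWithin
      (uniqueMDiffWithinAt_iff_uniqueDiffWithinAt.2 (uniqueDiffOn_Icc_zero_one t ht))
    have h4 := congrArg (fun L ↦ L (1 : ℝ)) h3
    refine h4.trans ?_
    have h6 := (mfderivWithin 𝓘(ℝ) (𝓡 n) γ (Icc 0 1) (1 - t)).map_neg (1 : ℝ)
    rw [← h6]
    refine congrArg (mfderivWithin 𝓘(ℝ) (𝓡 n) γ (Icc 0 1) (1 - t)) ?_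
    exact one_smul ℝ (-1 : ℝ)
  have h1 := HasDerivWithinAt.scomp t h hd hmaps
  unfold HasCovDerivAlongWithinAt
  refine h1.congr_deriv ?_
  have hx := FiberBundle.mem_baseSet_trivializationAt' (F := EuclideanSpace ℝ (Fin n))
    (E := (TangentSpace (𝓡 n) : M → Type _)) (γ (1 - t))
  have hlin := (trivializationAt (EuclideanSpace ℝ (Fin n))
    (TangentSpace (𝓡 n) : M → Type _) (γ (1 - t))).linear ℝ hx
  refine (hlin.map_smul (-1 : ℝ) _).symm.trans ?_
  refine congrArg (fun w : TangentSpace (𝓡 n) (γ (1 - t)) ↦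
    ((trivializationAt (EuclideanSpace ℝ (Fin n)) (TangentSpace (𝓡 n) : M → Type _) (γ (1 - t)))
      ⟨γ (1 - t), w⟩).2) ?_
  have h2 := (D.cov (FiberBundle.extend (EuclideanSpace ℝ (Fin n)) (V (1 - t)))
    (γ (1 - t))).map_neg (mfderivWithin 𝓘(ℝ) (𝓡 n) γ (Icc 0 1) (1 - t) (1 : ℝ))
  rw [zero_sub, zero_sub, neg_smul, one_smul, neg_neg]
  refine Eq.trans ?_ (congrArg Neg.neg ((congrArg (D.cov (FiberBundle.extend
    (EuclideanSpace ℝ (Fin n)) (V (1 - t))) (γ (1 - t))) hvel).trans h2)).symm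
  exact (neg_neg _).symm

theorem IsParallelTranslationAlong.reverse {D : LinearConnection n M} {γ : ℝ → M} {x y : M}
    {τ : TangentSpace (𝓡 n) x ≃ₗ[ℝ] TangentSpace (𝓡 n) y}
    (h : D.IsParallelTranslationAlong γ x y τ) :
    D.IsParallelTranslationAlong (fun u ↦ γ (1 - u)) y x τ.symm := by
  obtain ⟨hγ, h0, h1, hV⟩ := h
  refine ⟨?_, by simpa using h1, by simpa using h0, fun w ↦ ?_⟩
  · refine hγ.comp (ContDiffOn.contMDiffOn (by fun_prop)) ?_
    exact fun u hu ↦ ⟨by linarith [hu.2], by linarith [hu.1]⟩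
  · obtain ⟨V, hpar, hV0, hV1⟩ := hV (τ.symm w)
    refine ⟨fun u ↦ V (1 - u), fun t ht ↦ ?_, ?_, ?_⟩
    · exact (hpar (1 - t) ⟨by linarith [ht.2], by linarith [ht.1]⟩).reverse hγ ht
    · have e : (1 : ℝ) - 0 = 1 := by norm_num
      rw [τ.apply_symm_apply] at hV1
      refine Eq.trans ?_ hV1
      exact congrArg (fun r : ℝ ↦ (⟨γ r, V r⟩ : TangentBundle (𝓡 n) M)) e
    · have e : (1 : ℝ) - 1 = 0 := by norm_num
      refine Eq.trans ?_ hV0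
      exact congrArg (fun r : ℝ ↦ (⟨γ r, V r⟩ : TangentBundle (𝓡 n) M)) e

theorem IsParallelTranslation.symm {D : LinearConnection n M} {x y : M}
    {τ : TangentSpace (𝓡 n) x ≃ₗ[ℝ] TangentSpace (𝓡 n) y} (h : D.IsParallelTranslation x y τ) :
    D.IsParallelTranslation y x τ.symm := by
  induction h with
  | of_curve γ h => exact .of_curve _ h.reverse
  | concat h h' ih ih' => exact .concat ih' ih

/-- The holonomy group `Ψ(x)` of the connection at `x`: the parallel translations along piecewise
`C¹` loops at `x`. -/
def holonomyGroup (D : LinearConnection n M) (x : M) :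
    Subgroup (TangentSpace (𝓡 n) x ≃ₗ[ℝ] TangentSpace (𝓡 n) x) where
  carrier := {ψ | D.IsParallelTranslation x x ψ}
  mul_mem' ha hb := IsParallelTranslation.concat hb ha
  one_mem' := D.isParallelTranslation_refl x
  inv_mem' h := IsParallelTranslation.symm h

end LinearConnection

end

/-- The group `G` of linear automorphisms of `V` acts reducibly: some proper nontrivial subspace is
invariant. -/
def ActsReducibly {V : Type*} [AddCommGroup V] [Module ℝ V] (G : Subgroup (V ≃ₗ[ℝ] V)) : Prop :=
  ∃ W : Submodule ℝ V, W ≠ ⊥ ∧ W ≠ ⊤ ∧ ∀ ψ ∈ G, ∀ v ∈ W, ψ v ∈ W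

/-- The connection has reducible holonomy: its holonomy groups act reducibly. (On a connected
manifold, this holds at one point if and only if it holds at all points.) -/
def LinearConnection.HasReducibleHolonomy {n : ℕ} {M : Type*} [TopologicalSpace M]
    [ChartedSpace (EuclideanSpace ℝ (Fin n)) M] [IsManifold (𝓡 n) ∞ M]
    (D : LinearConnection n M) : Prop :=
  ∀ x : M, ActsReducibly (D.holonomyGroup x)

/-- `g₁, …, g_k` are `k` independent metrics, all parallel with respect to the connection:
independent means linearly independent over `ℝ` as tensor fields on `M`. -/
def LinearConnection.AreIndependentParallelMetrics {n : ℕ} {M : Type*} [TopologicalSpace M]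
    [ChartedSpace (EuclideanSpace ℝ (Fin n)) M] [IsManifold (𝓡 n) ∞ M]
    (D : LinearConnection n M) {k : ℕ} (g : Fin k → SemiRiemannianMetric n M) : Prop :=
  (∀ c : Fin k → ℝ, (∀ (x : M) (v w : TangentSpace (𝓡 n) x), ∑ i, c i * (g i).toFun x v w = 0) →
    ∀ i, c i = 0) ∧ ∀ i, (g i).IsParallel D

end

open scoped Topology

/-! A parallel field of bilinear forms solves a linear differential equation along every curve, so
it is determined by its value at one point. Independent parallel metrics therefore stay independent
at each point `x`, where they are symmetric forms invariant under the holonomy group `Ψ(x)`. If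
`Ψ(x)` acts irreducibly, its commutant is by Schur's lemma a finite-dimensional real division
algebra, and raising an index with one invariant metric `b` identifies the invariant symmetric forms
with the `b`-self-adjoint elements of the commutant. A self-adjoint element that is not a scalar
yields a self-adjoint complex structure `J`; then `b (J v) (J v) = -b v v`, so the signature is
neutral. In dimension two, every element of `Ψ(x)` commutes with `J`, so it has the form `p + q J`
and is self-adjoint; being an isometry as well, it squares to `1` and is therefore `±1`. Three
independent forms yield two anticommuting complex structures, which make `T_x M` a quaternionic
vector space. Four would make the whole commutant self-adjoint, hence commutative, contradicting the
noncommutativity of the quaternions. -/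

section Anticommutation

-- Anticommutation, `a * j = -j * a`, is expressed as `SemiconjBy a j (-j)`.

variable {R : Type*} [Ring R] {j : R}

theorem semiconjBy_neg_add_mul_mul (hj : j * j = -1) (a : R) :
    SemiconjBy (a + j * a * j) j (-j) := by
  simp only [SemiconjBy, add_mul, mul_add, neg_mul, mul_assoc, hj]
  simp only [← mul_assoc, hj]
  noncomm_ring

theorem commute_sub_mul_mul (hj : j * j = -1) (a : R) : Commute (a - j * a * j) j := by
  simp only [Commute, SemiconjBy, sub_mul, mul_sub, mul_assoc, hj]
  simp only [← mul_assoc, hj]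
  noncomm_ring

theorem commute_mul_of_semiconjBy_neg {a b : R} (ha : SemiconjBy a j (-j))
    (hb : SemiconjBy b j (-j)) : Commute (a * b) j := by
  have h : SemiconjBy (a * b) j (- -j) := ha.neg_right.mul_left hb
  rwa [neg_neg] at h

theorem commute_of_add_mul_mul_eq_zero {a : R} (hj : j * j = -1) (h : a + j * a * j = 0) :
    Commute a j := by
  rw [commute_iff_eq]
  nth_rw 1 [eq_neg_of_add_eq_zero_left h]
  rw [neg_mul, mul_assoc, hj, mul_neg, mul_one, neg_neg]

end Anticommutation

section RealDomain

variable {R : Type*} [Ring R] [Algebra ℝ R] [NoZeroDivisors R] [Nontrivial R]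

theorem eq_zero_of_commute_of_semiconjBy_neg {a j : R} (hj : j * j = -1) (hc : Commute a j)
    (h : SemiconjBy a j (-j)) : a = 0 := by
  have : IsAddTorsionFree R := .of_isTorsionFree ℝ R
  have hja : j * a = -(j * a) := by rw [← neg_mul, ← h.eq, hc.eq]
  refine (mul_eq_zero.1 (self_eq_neg.1 hja)).resolve_left ?_
  rintro rfl
  simp at hj

variable [FiniteDimensional ℝ R]

theorem nonempty_algEquiv_real_or_complex (h : ∀ a b : R, a * b = b * a) :
    Nonempty (R ≃ₐ[ℝ] ℝ) ∨ Nonempty (R ≃ₐ[ℝ] ℂ) := by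
  let _ : CommRing R := { ‹Ring R› with mul_comm := h }
  have : IsDomain R := NoZeroDivisors.to_isDomain R
  let _ : Field R := fieldOfFiniteDimensional ℝ R
  exact Real.nonempty_algEquiv_or R

theorem finrank_le_two_of_mul_comm (h : ∀ a b : R, a * b = b * a) : Module.finrank ℝ R ≤ 2 := by
  rcases nonempty_algEquiv_real_or_complex h with ⟨⟨e⟩⟩ | ⟨⟨e⟩⟩ <;>
    simp [e.toLinearEquiv.finrank_eq]

theorem exists_eq_smul_one_add_smul_of_notMem_bot {a : R} (ha : a ∉ (⊥ : Subalgebra ℝ R)) :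
    ∃ j : R, j * j = -1 ∧ ∃ r s : ℝ, s ≠ 0 ∧ a = r • 1 + s • j := by
  have hcomm (b c : Algebra.adjoin ℝ {a}) : b * c = c * b :=
    Subtype.ext <| Algebra.commute_of_mem_adjoin_singleton_of_commute c.2
      (Algebra.commute_of_mem_adjoin_self b.2).symm
  let x : Algebra.adjoin ℝ {a} := ⟨a, Algebra.self_mem_adjoin_singleton ℝ a⟩
  rcases nonempty_algEquiv_real_or_complex hcomm with ⟨⟨e⟩⟩ | ⟨⟨e⟩⟩
  · refine absurd (Algebra.mem_bot.2 ⟨e x, ?_⟩) ha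
    simpa using congrArg Subtype.val (e.symm.commutes (e x)).symm
  · let f : ℂ →ₐ[ℝ] R := (Algebra.adjoin ℝ {a}).val.comp e.symm
    have hfx : a = (e x).re • 1 + (e x).im • f Complex.I := calc
      a = f (e x) := congrArg Subtype.val (e.symm_apply_apply x).symm
      _ = f ((e x).re • 1 + (e x).im • Complex.I) := by simp
      _ = _ := by rw [map_add, map_smul, map_smul, map_one]
    refine ⟨f Complex.I, by rw [← map_mul, Complex.I_mul_I, map_neg, map_one], _, _, ?_, hfx⟩
    intro h0
    rw [h0, zero_smul, add_zero] at hfx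
    exact ha (hfx ▸ Subalgebra.smul_mem _ (one_mem _) _)

theorem mem_span_one_of_commute {a j : R} (hj : j * j = -1) (h : Commute a j) :
    a ∈ Submodule.span ℝ {1, j} := by
  rw [Submodule.mem_span_pair]
  by_cases ha : a ∈ (⊥ : Subalgebra ℝ R)
  · obtain ⟨r, rfl⟩ := Algebra.mem_bot.1 ha
    exact ⟨r, 0, by rw [zero_smul, add_zero, Algebra.algebraMap_eq_smul_one]⟩
  obtain ⟨k, hk, r, s, hs, rfl⟩ := exists_eq_smul_one_add_smul_of_notMem_bot ha
  have hkj : Commute k j := by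
    have := (h.sub_left ((Commute.one_left j).smul_left r)).smul_left s⁻¹
    rwa [add_sub_cancel_left, inv_smul_smul₀ hs] at this
  rcases hkj.mul_self_eq_mul_self_iff.1 (hk.trans hj.symm) with rfl | rfl
  · exact ⟨r, s, rfl⟩
  · exact ⟨r, -s, by rw [neg_smul, smul_neg]⟩

theorem exists_eq_smul_of_semiconjBy_neg {a j : R} (hj : j * j = -1) (h : SemiconjBy a j (-j))
    (ha : a ≠ 0) : ∃ k : R, k * k = -1 ∧ ∃ s : ℝ, s ≠ 0 ∧ a = s • k := by
  have not_commute : ¬ Commute a j :=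
    fun hc ↦ ha (eq_zero_of_commute_of_semiconjBy_neg hj hc h)
  have hbot : a ∉ (⊥ : Subalgebra ℝ R) := fun hmem ↦ by
    obtain ⟨c, rfl⟩ := Algebra.mem_bot.1 hmem
    exact not_commute (Algebra.commutes c j)
  obtain ⟨k, hk, r, s, hs, rfl⟩ := exists_eq_smul_one_add_smul_of_notMem_bot hbot
  suffices r = 0 by exact ⟨k, hk, s, hs, by rw [this, zero_smul, zero_add]⟩
  by_contra hr
  set a := r • (1 : R) + s • k with ha'
  have hsq : a * a + (r * r + s * s) • 1 = (2 * r) • a := by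
    simp only [ha', mul_add, add_mul, smul_mul_assoc, mul_smul_comm, one_mul, mul_one, hk]
    module
  have hcomm : Commute ((2 * r) • a) j :=
    hsq ▸ (commute_mul_of_semiconjBy_neg h h).add_left
      ((Commute.one_left j).smul_left (r * r + s * s))
  exact not_commute (by simpa [smul_smul, hr] using hcomm.smul_left (2 * r)⁻¹)

theorem exists_anticommuting_of_mul_ne_mul {a b : R} (hab : a * b ≠ b * a) :
    ∃ j k : R, j * j = -1 ∧ k * k = -1 ∧ SemiconjBy k j (-j) := by
  obtain ⟨j, hj, r, s, -, rfl⟩ := exists_eq_smul_one_add_smul_of_notMem_bot (a := a) fun h ↦ by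
    obtain ⟨c, rfl⟩ := Algebra.mem_bot.1 h
    exact hab (Algebra.commutes c b)
  have hanti := semiconjBy_neg_add_mul_mul hj b
  have hne : b + j * b * j ≠ 0 := fun h ↦ by
    have hbj : Commute b j := commute_of_add_mul_mul_eq_zero hj h
    exact hab (((Commute.one_left b).smul_left r).add_left (hbj.symm.smul_left s)).eq
  obtain ⟨k, hk, t, ht, hbk⟩ := exists_eq_smul_of_semiconjBy_neg hj hanti hne
  rw [hbk] at hanti
  exact ⟨j, k, hj, hk, (SemiconjBy.smul_left_iff₀ ht).1 hanti⟩

theorem finrank_le_four_of_noZeroDivisors : Module.finrank ℝ R ≤ 4 := by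
  classical
  by_cases hcomm : ∀ a b : R, a * b = b * a
  · exact (finrank_le_two_of_mul_comm hcomm).trans (by norm_num)
  push Not at hcomm
  obtain ⟨a, b, hab⟩ := hcomm
  obtain ⟨j, k, hj, hk, hkj⟩ := exists_anticommuting_of_mul_ne_mul hab
  let P : Submodule ℝ R := Submodule.span ℝ (({1, j} : Finset R) : Set R)
  let Pk : Submodule ℝ R := P.map (LinearMap.mulRight ℝ k)
  have hP : Module.finrank ℝ P ≤ 2 := (finrank_span_finset_le_card _).trans Finset.card_le_two
  have mem_P {c : R} (hc : Commute c j) : c ∈ P := by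
    simpa [P] using mem_span_one_of_commute hj hc
  have htop : P ⊔ Pk = ⊤ := by
    refine eq_top_iff.2 fun c _ ↦ ?_
    have h1 : c - j * c * j ∈ P := mem_P (commute_sub_mul_mul hj c)
    have h2 : (c + j * c * j) * k ∈ P :=
      mem_P (commute_mul_of_semiconjBy_neg (semiconjBy_neg_add_mul_mul hj c) hkj)
    have h3 : -(c + j * c * j) ∈ Pk := ⟨_, h2, by simp [mul_assoc, hk]⟩
    have hc : c = (2⁻¹ : ℝ) • ((c - j * c * j) - -(c + j * c * j)) := by module
    rw [hc]
    exact Submodule.smul_mem _ _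
      (sub_mem (Submodule.mem_sup_left h1) (Submodule.mem_sup_right h3))
  calc Module.finrank ℝ R = Module.finrank ℝ ↥(P ⊔ Pk) := by rw [htop, finrank_top]
    _ ≤ Module.finrank ℝ P + Module.finrank ℝ Pk :=
      Submodule.finrank_add_le_finrank_add_finrank P Pk
    _ ≤ 2 + 2 := add_le_add hP ((Submodule.finrank_map_le _ _).trans hP)

end RealDomain

section Commutant

variable {V : Type*} [AddCommGroup V] [Module ℝ V]

/-- The algebra of endomorphisms commuting with every element of `G`. -/
def commutant (G : Subgroup (V ≃ₗ[ℝ] V)) : Subalgebra ℝ (Module.End ℝ V) :=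
  Subalgebra.centralizer ℝ ((fun ψ : V ≃ₗ[ℝ] V ↦ (ψ : Module.End ℝ V)) '' G)

variable {G : Subgroup (V ≃ₗ[ℝ] V)}

theorem mem_commutant {A : Module.End ℝ V} :
    A ∈ commutant G ↔ ∀ ψ ∈ G, ∀ v, A (ψ v) = ψ (A v) := by
  simp only [commutant, Subalgebra.mem_centralizer_iff, Set.forall_mem_image]
  exact forall₂_congr fun ψ _ ↦ eq_comm.trans LinearMap.ext_iff

theorem ker_eq_bot_of_mem_commutant (hG : ¬ ActsReducibly G) {A : Module.End ℝ V}
    (hA : A ∈ commutant G) (h0 : A ≠ 0) : LinearMap.ker A = ⊥ := by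
  by_contra h
  refine hG ⟨LinearMap.ker A, h, fun ht ↦ h0 (LinearMap.ker_eq_top.1 ht), fun ψ hψ v hv ↦ ?_⟩
  rw [LinearMap.mem_ker] at hv ⊢
  rw [mem_commutant.1 hA ψ hψ, hv, map_zero]

theorem noZeroDivisors_commutant (hG : ¬ ActsReducibly G) : NoZeroDivisors (commutant G) where
  eq_zero_or_eq_zero_of_mul_eq_zero {A B} h := by
    refine or_iff_not_imp_left.2 fun hA ↦ Subtype.ext (LinearMap.ext fun v ↦ ?_)
    have hker := ker_eq_bot_of_mem_commutant hG A.2 fun h ↦ hA (Subtype.ext h)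
    exact LinearMap.ker_eq_bot'.1 hker _ (LinearMap.congr_fun (congrArg Subtype.val h) v)

theorem four_dvd_finrank_of_semiconjBy_neg {J K : Module.End ℝ V} (hJ : J * J = -1)
    (hK : K * K = -1) (hKJ : SemiconjBy K J (-J)) : 4 ∣ Module.finrank ℝ V := by
  let q : QuaternionAlgebra.Basis (Module.End ℝ V) (-1 : ℝ) 0 (-1) :=
    { i := J, j := K, k := J * K
      i_mul_i := by simp [hJ]
      j_mul_j := by simp [hK]
      i_mul_j := rfl
      j_mul_i := by simp [hKJ.eq] }
  let _ : Module (Quaternion ℝ) V := Module.compHom V q.liftHom.toRingHom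
  have : IsScalarTower ℝ (Quaternion ℝ) V :=
    ⟨fun r x v ↦ LinearMap.congr_fun (map_smul q.liftHom r x) v⟩
  rw [← Module.finrank_mul_finrank ℝ (Quaternion ℝ) V, Quaternion.finrank_eq_four]
  exact dvd_mul_right _ _

theorem four_dvd_finrank_of_two_lt_finrank_commutant [FiniteDimensional ℝ V] [Nontrivial V]
    (hG : ¬ ActsReducibly G) (h : 2 < Module.finrank ℝ (commutant G)) :
    4 ∣ Module.finrank ℝ V := by
  have := noZeroDivisors_commutant hG
  obtain ⟨A, B, hAB⟩ : ∃ A B : commutant G, A * B ≠ B * A := by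
    by_contra! hcomm
    exact h.not_ge (finrank_le_two_of_mul_comm hcomm)
  obtain ⟨J, K, hJ, hK, hKJ⟩ := exists_anticommuting_of_mul_ne_mul hAB
  exact four_dvd_finrank_of_semiconjBy_neg (congrArg Subtype.val hJ) (congrArg Subtype.val hK)
    (congrArg Subtype.val hKJ)

end Commutant

theorem linearIndependent_bilinForm_iff {ι R V : Type*} [Fintype ι] [CommRing R]
    [AddCommGroup V] [Module R V] {B : ι → LinearMap.BilinForm R V} :
    LinearIndependent R B ↔
      ∀ c : ι → R, (∀ v w, ∑ i, c i * B i v w = 0) → ∀ i, c i = 0 :=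
  (Fintype.linearIndependent_iff (M := LinearMap.BilinForm R V)).trans <| by
    simp [LinearMap.ext_iff₂]

section InvariantForms

variable {V : Type*} [AddCommGroup V] [Module ℝ V]

/-- The symmetric bilinear forms that are invariant under `G`. -/
def invariantSymmForms (G : Subgroup (V ≃ₗ[ℝ] V)) : Submodule ℝ (LinearMap.BilinForm ℝ V) where
  carrier := {b | (∀ v w, b v w = b w v) ∧ ∀ ψ ∈ G, ∀ v w, b (ψ v) (ψ w) = b v w}
  add_mem' hb hc := ⟨fun v w ↦ congrArg₂ (· + ·) (hb.1 v w) (hc.1 v w),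
    fun ψ hψ v w ↦ congrArg₂ (· + ·) (hb.2 ψ hψ v w) (hc.2 ψ hψ v w)⟩
  zero_mem' := ⟨fun _ _ ↦ rfl, fun _ _ _ _ ↦ rfl⟩
  smul_mem' c _ hb := ⟨fun v w ↦ congrArg (c • ·) (hb.1 v w),
    fun ψ hψ v w ↦ congrArg (c • ·) (hb.2 ψ hψ v w)⟩

/-- The endomorphisms in the commutant of `G` that are self-adjoint with respect to `b`. -/
def selfAdjointCommutant (G : Subgroup (V ≃ₗ[ℝ] V)) (b : LinearMap.BilinForm ℝ V) :
    Submodule ℝ (commutant G) :=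
  (LinearMap.selfAdjointSubmodule b).comap (commutant G).val.toLinearMap

variable {G : Subgroup (V ≃ₗ[ℝ] V)} {b : LinearMap.BilinForm ℝ V}

theorem mem_selfAdjointCommutant {A : commutant G} :
    A ∈ selfAdjointCommutant G b ↔ ∀ v w, b (A.1 v) w = b v (A.1 w) :=
  Iff.rfl

theorem one_mem_selfAdjointCommutant : (1 : commutant G) ∈ selfAdjointCommutant G b :=
  fun _ _ ↦ rfl

/-- Raising an index with `b`: the form `B` becomes the endomorphism `A` with
`b (A v) w = B v w`. -/
noncomputable def raiseIndex [FiniteDimensional ℝ V] (hb : b.Nondegenerate) :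
    LinearMap.BilinForm ℝ V ≃ₗ[ℝ] Module.End ℝ V :=
  (b.toDual hb).symm.congrRight

theorem apply_raiseIndex [FiniteDimensional ℝ V] (hb : b.Nondegenerate)
    (B : LinearMap.BilinForm ℝ V) (v w : V) : b (raiseIndex hb B v) w = B v w :=
  b.apply_toDual_symm_apply (hB := hb) (B v) w

theorem raiseIndex_mem_commutant [FiniteDimensional ℝ V] (hb : b.Nondegenerate)
    (hbG : b ∈ invariantSymmForms G) {B : LinearMap.BilinForm ℝ V}
    (hB : B ∈ invariantSymmForms G) : raiseIndex hb B ∈ commutant G := by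
  refine mem_commutant.2 fun ψ hψ v ↦ (b.toDual hb).injective (LinearMap.ext fun w ↦ ?_)
  obtain ⟨w, rfl⟩ := ψ.surjective w
  change b _ _ = b _ _
  rw [apply_raiseIndex, hB.2 ψ hψ, hbG.2 ψ hψ, apply_raiseIndex]

theorem finrank_invariantSymmForms_le [FiniteDimensional ℝ V] (hb : b.Nondegenerate)
    (hbG : b ∈ invariantSymmForms G) :
    Module.finrank ℝ (invariantSymmForms G) ≤ Module.finrank ℝ (selfAdjointCommutant G b) := by
  have hle : (invariantSymmForms G).map (raiseIndex hb).toLinearMap ≤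
      (selfAdjointCommutant G b).map (commutant G).val.toLinearMap := by
    rintro _ ⟨B, hB, rfl⟩
    refine ⟨⟨_, raiseIndex_mem_commutant hb hbG hB⟩, fun v w ↦ ?_, rfl⟩
    change b (raiseIndex hb B v) w = b v (raiseIndex hb B w)
    rw [hbG.1 v, apply_raiseIndex, apply_raiseIndex, hB.1]
  calc Module.finrank ℝ (invariantSymmForms G)
      = Module.finrank ℝ ((invariantSymmForms G).map (raiseIndex hb).toLinearMap) :=
        ((raiseIndex hb).finrank_map_eq _).symm
    _ ≤ Module.finrank ℝ ((selfAdjointCommutant G b).map (commutant G).val.toLinearMap) :=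
        Submodule.finrank_mono hle
    _ ≤ _ := Submodule.finrank_map_le _ _

theorem commutant_mul_comm_of_selfAdjointCommutant_eq_top (hb : b.Nondegenerate)
    (h : selfAdjointCommutant G b = ⊤) (A B : commutant G) : A * B = B * A := by
  have sa (A : commutant G) (v w) : b (A.1 v) w = b v (A.1 w) :=
    mem_selfAdjointCommutant.1 (h ▸ Submodule.mem_top) v w
  refine Subtype.ext (LinearMap.ext fun v ↦ sub_eq_zero.1 (hb.1 _ fun w ↦ ?_))
  rw [map_sub, LinearMap.sub_apply, sa (A * B), sub_eq_zero]
  change b v (A.1 (B.1 w)) = b (B.1 (A.1 v)) w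
  rw [← sa A, ← sa B]

theorem exists_mul_self_eq_neg_one_mem_selfAdjointCommutant [FiniteDimensional ℝ V] [Nontrivial V]
    (hG : ¬ ActsReducibly G) (h : 1 < Module.finrank ℝ (selfAdjointCommutant G b)) :
    ∃ J ∈ selfAdjointCommutant G b, J * J = -1 := by
  have := noZeroDivisors_commutant hG
  obtain ⟨A, hA, hbot⟩ : ∃ A ∈ selfAdjointCommutant G b, A ∉ (⊥ : Subalgebra ℝ (commutant G)) := by
    by_contra! hle
    have := Submodule.finrank_mono (t := Subalgebra.toSubmodule (⊥ : Subalgebra ℝ _)) hle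
    rw [Subalgebra.finrank_toSubmodule, Subalgebra.finrank_bot] at this
    exact h.not_ge this
  obtain ⟨J, hJ, r, s, hs, rfl⟩ := exists_eq_smul_one_add_smul_of_notMem_bot hbot
  refine ⟨J, ?_, hJ⟩
  rwa [Submodule.add_mem_iff_right _ (Submodule.smul_mem _ _ one_mem_selfAdjointCommutant),
    Submodule.smul_mem_iff _ hs] at hA

theorem finrank_selfAdjointCommutant_lt_four [FiniteDimensional ℝ V] [Nontrivial V]
    (hG : ¬ ActsReducibly G) (hb : b.Nondegenerate) :
    Module.finrank ℝ (selfAdjointCommutant G b) < 4 := by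
  have := noZeroDivisors_commutant hG
  by_contra! h
  have htop : selfAdjointCommutant G b = ⊤ := Submodule.eq_top_of_finrank_eq <|
    (Submodule.finrank_le _).antisymm (finrank_le_four_of_noZeroDivisors.trans h)
  have := finrank_le_two_of_mul_comm (commutant_mul_comm_of_selfAdjointCommutant_eq_top hb htop)
  have := (selfAdjointCommutant G b).finrank_le
  omega

end InvariantForms

section ComplexStructure

variable {V : Type*} [AddCommGroup V] [Module ℝ V] {b : LinearMap.BilinForm ℝ V}
  {J : Module.End ℝ V}

theorem sigPos_eq_sigNeg_of_isSelfAdjoint (hJ : J * J = -1) (hb : b.IsSelfAdjoint J) :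
    sigPos b.toQuadraticMap = sigNeg b.toQuadraticMap := by
  have hJJ (v : V) : J (J v) = -v := LinearMap.congr_fun hJ v
  let e : V ≃ₗ[ℝ] V := .ofLinearMap J (-J) (by ext; simp [hJJ]) (by ext; simp [hJJ])
  -- `J` is an isometry from `b` to `-b`, since `b (J v) (J v) = b v (J (J v)) = -b v v`.
  have hneg : QuadraticMap.Equivalent b.toQuadraticMap (-b.toQuadraticMap) :=
    ⟨e, fun v ↦ by simp [e, hb v (J v), hJJ]⟩
  rw [hneg.sigPos_eq, sigPos_neg]

theorem mem_span_one_of_commute_of_finrank_eq_two (hV : Module.finrank ℝ V = 2)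
    (hJ : J * J = -1) {A : Module.End ℝ V} (h : Commute A J) : A ∈ Submodule.span ℝ {1, J} := by
  have hJJ (v : V) : J (J v) = -v := LinearMap.congr_fun hJ v
  have : Nontrivial V := Module.nontrivial_of_finrank_pos (R := ℝ) (by omega)
  obtain ⟨v, hv⟩ := exists_ne (0 : V)
  have hli : LinearIndependent ℝ ![v, J v] := by
    refine (LinearIndependent.pair_iff' hv).2 fun c hc ↦ ?_
    have hsq : (c ^ 2 + 1) • v = 0 := by
      rw [add_smul, sq, mul_smul, hc, ← map_smul, hc, hJJ, one_smul, neg_add_cancel]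
    exact hv ((smul_eq_zero.1 hsq).resolve_left (by positivity))
  have htop := hli.span_eq_top_of_card_eq_finrank (by simp [hV])
  obtain ⟨p, q, hpq⟩ : ∃ p q : ℝ, p • v + q • J v = A v := by
    rw [← Submodule.mem_span_pair, ← Matrix.range_cons_cons_empty, htop]
    exact Submodule.mem_top
  refine Submodule.mem_span_pair.2 ⟨p, q, LinearMap.ext_on_range htop fun i ↦ ?_⟩
  fin_cases i
  · exact hpq
  · calc p • J v + q • J (J v) = J (A v) := by rw [← hpq, map_add, map_smul, map_smul]
      _ = A (J v) := (LinearMap.congr_fun h v).symm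

end ComplexStructure

section Reducibility

variable {V : Type*} [AddCommGroup V] [Module ℝ V] {G : Subgroup (V ≃ₗ[ℝ] V)}
  {b : LinearMap.BilinForm ℝ V}

theorem actsReducibly_of_forall_mem_span_singleton (hV : 1 < Module.finrank ℝ V)
    (h : ∀ ψ ∈ G, ∀ v, ψ v ∈ ℝ ∙ v) : ActsReducibly G := by
  have : Nontrivial V := Module.nontrivial_of_finrank_pos (R := ℝ) (by omega)
  obtain ⟨v, hv⟩ := exists_ne (0 : V)
  refine ⟨ℝ ∙ v, by simpa using hv, fun htop ↦ ?_, fun ψ hψ w hw ↦ ?_⟩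
  · have := finrank_span_singleton (K := ℝ) hv
    rw [htop, finrank_top] at this
    omega
  · exact (Submodule.span_singleton_le_iff_mem _ _).2 hw (h ψ hψ w)

theorem actsReducibly_of_finrank_eq_two (hV : Module.finrank ℝ V = 2) (hb : b.Nondegenerate)
    (hbG : b ∈ invariantSymmForms G) {J : commutant G} (hJ : J * J = -1)
    (hJb : J ∈ selfAdjointCommutant G b) : ActsReducibly G := by
  by_contra hG
  have := noZeroDivisors_commutant hG
  refine hG (actsReducibly_of_forall_mem_span_singleton (by omega) fun ψ hψ v ↦ ?_)
  have hcomm : Commute (ψ : Module.End ℝ V) J.1 :=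
    (LinearMap.ext fun v ↦ mem_commutant.1 J.2 ψ hψ v).symm
  obtain ⟨p, q, hpq⟩ := Submodule.mem_span_pair.1 <|
    mem_span_one_of_commute_of_finrank_eq_two hV (congrArg Subtype.val hJ) hcomm
  let A : commutant G := p • 1 + q • J
  have hAψ (w : V) : A.1 w = ψ w := LinearMap.congr_fun hpq w
  have hA : A ∈ selfAdjointCommutant G b :=
    add_mem (Submodule.smul_mem _ _ one_mem_selfAdjointCommutant) (Submodule.smul_mem _ _ hJb)
  -- `ψ` is both a self-adjoint element of the commutant and an isometry, so `ψ ^ 2 = 1`.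
  have hsq : A * A = 1 := by
    refine Subtype.ext (LinearMap.ext fun w ↦ sub_eq_zero.1 (hb.1 _ fun u ↦ ?_))
    rw [map_sub, LinearMap.sub_apply, sub_eq_zero]
    calc b (A.1 (A.1 w)) u = b (A.1 w) (A.1 u) := hA _ _
      _ = b w u := by rw [hAψ, hAψ, hbG.2 ψ hψ]
  rw [← hAψ, Submodule.mem_span_singleton]
  rcases mul_self_eq_one_iff.1 hsq with h | h
  · exact ⟨1, by simp [h]⟩
  · exact ⟨-1, by simp [h]⟩

theorem nontrivial_of_finrank_invariantSymmForms_pos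
    (h : 0 < Module.finrank ℝ (invariantSymmForms G)) : Nontrivial V := by
  by_contra hV
  rw [not_nontrivial_iff_subsingleton] at hV
  exact h.ne' (Module.finrank_zero_of_subsingleton)

variable [FiniteDimensional ℝ V]

theorem actsReducibly_of_sigPos_ne_sigNeg (hb : b.Nondegenerate) (hbG : b ∈ invariantSymmForms G)
    (hsig : sigPos b.toQuadraticMap ≠ sigNeg b.toQuadraticMap)
    (h : 1 < Module.finrank ℝ (invariantSymmForms G)) : ActsReducibly G := by
  by_contra hG
  have := nontrivial_of_finrank_invariantSymmForms_pos (zero_lt_one.trans h)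
  obtain ⟨J, hJb, hJ⟩ := exists_mul_self_eq_neg_one_mem_selfAdjointCommutant hG
    (h.trans_le (finrank_invariantSymmForms_le hb hbG))
  exact hsig (sigPos_eq_sigNeg_of_isSelfAdjoint (congrArg Subtype.val hJ) hJb)

theorem actsReducibly_of_one_lt_finrank_invariantSymmForms (hV : Module.finrank ℝ V = 2)
    (hb : b.Nondegenerate) (hbG : b ∈ invariantSymmForms G)
    (h : 1 < Module.finrank ℝ (invariantSymmForms G)) : ActsReducibly G := by
  by_contra hG
  have := nontrivial_of_finrank_invariantSymmForms_pos (zero_lt_one.trans h)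
  obtain ⟨J, hJb, hJ⟩ := exists_mul_self_eq_neg_one_mem_selfAdjointCommutant hG
    (h.trans_le (finrank_invariantSymmForms_le hb hbG))
  exact hG (actsReducibly_of_finrank_eq_two hV hb hbG hJ hJb)

theorem actsReducibly_of_two_lt_finrank_invariantSymmForms (hV : ¬ 4 ∣ Module.finrank ℝ V)
    (hb : b.Nondegenerate) (hbG : b ∈ invariantSymmForms G)
    (h : 2 < Module.finrank ℝ (invariantSymmForms G)) : ActsReducibly G := by
  by_contra hG
  have := nontrivial_of_finrank_invariantSymmForms_pos (zero_lt_two.trans h)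
  refine hV (four_dvd_finrank_of_two_lt_finrank_commutant hG ?_)
  exact h.trans_le ((finrank_invariantSymmForms_le hb hbG).trans (Submodule.finrank_le _))

theorem actsReducibly_of_three_lt_finrank_invariantSymmForms (hb : b.Nondegenerate)
    (hbG : b ∈ invariantSymmForms G) (h : 3 < Module.finrank ℝ (invariantSymmForms G)) :
    ActsReducibly G := by
  by_contra hG
  have := nontrivial_of_finrank_invariantSymmForms_pos (zero_lt_three.trans h)
  exact (h.trans_le (finrank_invariantSymmForms_le hb hbG)).not_ge
    (Nat.le_of_lt_succ (finrank_selfAdjointCommutant_lt_four hG hb))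

end Reducibility

noncomputable section

section Calculus

variable {E H M F G : Type*} [NormedAddCommGroup E] [NormedSpace ℝ E] [TopologicalSpace H]
  {I : ModelWithCorners ℝ E H} [TopologicalSpace M] [ChartedSpace H M]
  [NormedAddCommGroup F] [NormedSpace ℝ F] [NormedAddCommGroup G] [NormedSpace ℝ G] {x : M}

theorem contMDiffAt_clm_of_apply [FiniteDimensional ℝ F] {k : ℕ∞ω} {f : M → F →L[ℝ] G}
    (h : ∀ v, ContMDiffAt I 𝓘(ℝ, G) k (fun y ↦ f y v) x) :
    ContMDiffAt I 𝓘(ℝ, F →L[ℝ] G) k f x := by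
  have hF : Module.finrank ℝ F = Module.finrank ℝ (Fin (Module.finrank ℝ F) → ℝ) :=
    (Module.finrank_fin_fun ℝ).symm
  let e₁ : F ≃L[ℝ] Fin (Module.finrank ℝ F) → ℝ := .ofFinrankEq hF
  let e := (e₁.arrowCongr (1 : G ≃L[ℝ] G)).trans
    (ContinuousLinearEquiv.piRing (Fin (Module.finrank ℝ F)))
  have he : ContMDiffAt I 𝓘(ℝ, Fin (Module.finrank ℝ F) → G) k (fun y ↦ e (f y)) x :=
    contMDiffAt_pi_space.2 fun i ↦ h _
  simpa [Function.comp_def] using e.symm.contDiff.contMDiff.contMDiffAt.comp x he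

theorem hasMFDerivAt_clm_apply_const {f : M → F →L[ℝ] G}
    (hf : MDifferentiableAt I 𝓘(ℝ, F →L[ℝ] G) f x) (v : F) :
    HasMFDerivAt I 𝓘(ℝ, G) (fun y ↦ f y v) x
      ((ContinuousLinearMap.apply ℝ G v).comp (mvfderiv I f x)) :=
  (ContinuousLinearMap.apply ℝ G v).hasMFDerivAt.comp x hf.hasMFDerivAt

theorem mvfderiv_clm_apply_const₂ {f : M → F →L[ℝ] F →L[ℝ] G}
    (hf : MDifferentiableAt I 𝓘(ℝ, F →L[ℝ] F →L[ℝ] G) f x) (v w : F) (X : TangentSpace I x) :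
    mvfderiv I (fun y ↦ f y v w) x X = mvfderiv I f x X v w := by
  have h := hasMFDerivAt_clm_apply_const hf v
  have h' := hasMFDerivAt_clm_apply_const h.mdifferentiableAt w
  exact (congrArg (· X) h'.mfderiv).trans
    (congrArg (fun L : TangentSpace I x →L[ℝ] F →L[ℝ] G ↦ L X w) h.mfderiv)

theorem hasDerivWithinAt_comp_of_mdifferentiableAt {f : M → F} {γ : ℝ → M} {s : Set ℝ} {t : ℝ}
    {γ' : ℝ →L[ℝ] TangentSpace I (γ t)} (hf : MDifferentiableAt I 𝓘(ℝ, F) f (γ t))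
    (hγ : HasMFDerivWithinAt 𝓘(ℝ) I γ s t γ') :
    HasDerivWithinAt (fun u ↦ f (γ u)) (mvfderiv I f (γ t) (γ' 1)) s t :=
  HasFDerivWithinAt.hasDerivWithinAt (f' := (mvfderiv I f (γ t)).comp γ')
    (hf.hasMFDerivAt.comp_hasMFDerivWithinAt t hγ).hasFDerivWithinAt

theorem hasDerivWithinAt_bilin_apply_eq_zero {B : ℝ → F →L[ℝ] F →L[ℝ] G} {B' : F →L[ℝ] F →L[ℝ] G}
    {v w : ℝ → F} {v' w' : F} {s : Set ℝ} {t : ℝ} (hB : HasDerivWithinAt B B' s t)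
    (hv : HasDerivWithinAt v (-v') s t) (hw : HasDerivWithinAt w (-w') s t)
    (h : B' (v t) (w t) = B t v' (w t) + B t (v t) w') :
    HasDerivWithinAt (fun u ↦ B u (v u) (w u)) 0 s t := by
  refine ((hB.clm_apply hv).clm_apply hw).congr_deriv ?_
  rw [add_apply, h, map_neg, map_neg, neg_apply]
  abel

end Calculus

section Gronwall

variable {F : Type*} [NormedAddCommGroup F] [NormedSpace ℝ F]

theorem eq_zero_of_norm_hasDerivWithinAt_le {u u' : ℝ → F} {C : ℝ}
    (hu : ∀ t ∈ Icc (0 : ℝ) 1, HasDerivWithinAt u (u' t) (Icc 0 1) t)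
    (hu' : ∀ t ∈ Icc (0 : ℝ) 1, ‖u' t‖ ≤ C * ‖u t‖) (h0 : u 0 = 0) : u 1 = 0 :=
  eq_zero_of_abs_deriv_le_mul_abs_self_of_eq_zero_right (fun t ht ↦ (hu t ht).continuousWithinAt)
    (fun t ht ↦ (hu t (Ico_subset_Icc_self ht)).mono_of_mem_nhdsWithin
      (Icc_mem_nhdsGE_of_mem ht))
    h0 (fun t ht ↦ hu' t (Ico_subset_Icc_self ht)) 1 (by simp)

theorem norm_le_of_apply_eq_add {u u' : F →L[ℝ] F →L[ℝ] ℝ} {A : F →L[ℝ] F} {C : ℝ}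
    (hA : ‖A‖ ≤ C) (h : ∀ a b, u' a b = u (A a) b + u a (A b)) : ‖u'‖ ≤ 2 * C * ‖u‖ := by
  have hC : 0 ≤ C := (norm_nonneg A).trans hA
  refine ContinuousLinearMap.opNorm_le_bound₂ _ (by positivity) fun a b ↦ ?_
  calc ‖u' a b‖ ≤ ‖u (A a) b‖ + ‖u a (A b)‖ := h a b ▸ norm_add_le _ _
    _ ≤ ‖u‖ * ‖A a‖ * ‖b‖ + ‖u‖ * ‖a‖ * ‖A b‖ := add_le_add (u.le_opNorm₂ _ _) (u.le_opNorm₂ _ _)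
    _ ≤ ‖u‖ * (C * ‖a‖) * ‖b‖ + ‖u‖ * ‖a‖ * (C * ‖b‖) := by
      gcongr <;> exact A.le_of_opNorm_le hA _
    _ = 2 * C * ‖u‖ * ‖a‖ * ‖b‖ := by ring

theorem bilin_eq_zero_of_hasDerivWithinAt {u u' : ℝ → F →L[ℝ] F →L[ℝ] ℝ} {A : ℝ → F →L[ℝ] F}
    (hA : ContinuousOn A (Icc 0 1))
    (hu : ∀ t ∈ Icc (0 : ℝ) 1, HasDerivWithinAt u (u' t) (Icc 0 1) t)
    (hu' : ∀ t ∈ Icc (0 : ℝ) 1, ∀ a b, u' t a b = u t (A t a) b + u t a (A t b))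
    (h0 : u 0 = 0) : u 1 = 0 := by
  obtain ⟨C, hC⟩ := isCompact_Icc.exists_bound_of_continuousOn hA
  exact eq_zero_of_norm_hasDerivWithinAt_le (F := F →L[ℝ] F →L[ℝ] ℝ) hu
    (fun t ht ↦ norm_le_of_apply_eq_add (hC t ht) (hu' t ht)) h0

end Gronwall

section TangentFrame

variable {n : ℕ} {M : Type*} [TopologicalSpace M]
  [ChartedSpace (EuclideanSpace ℝ (Fin n)) M] [IsManifold (𝓡 n) ∞ M] {z y : M}

local notation "𝔼" => EuclideanSpace ℝ (Fin n)

variable (n) in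
/-- The trivialization of the tangent bundle over the domain of the chart at `z`, which provides
the coordinate frame used in all computations near `z`. -/
abbrev tangentTriv (z : M) := trivializationAt 𝔼 (TangentSpace (𝓡 n) : M → Type _) z

theorem mem_baseSet_tangentTriv_iff :
    y ∈ (tangentTriv n z).baseSet ↔ y ∈ (extChartAt (𝓡 n) z).source := by
  rw [TangentBundle.trivializationAt_baseSet, extChartAt_source]

theorem mem_baseSet_tangentTriv_self (z : M) : z ∈ (tangentTriv n z).baseSet :=
  FiberBundle.mem_baseSet_trivializationAt' z

theorem baseSet_tangentTriv_mem_nhds (hy : y ∈ (tangentTriv n z).baseSet) :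
    (tangentTriv n z).baseSet ∈ 𝓝 y :=
  (tangentTriv n z).open_baseSet.mem_nhds hy

/-- The vector field with constant coefficients `a` in the coordinate frame of the chart at `z`. It
is meaningful only on the domain of that chart. -/
def constField (z : M) (a : 𝔼) (y : M) : TangentSpace (𝓡 n) y :=
  (tangentTriv n z).symmL ℝ y a

/-- The coefficients of a tangent vector in the coordinate frame of the chart at `z`. -/
def coeff (z y : M) : TangentSpace (𝓡 n) y →L[ℝ] 𝔼 :=
  (tangentTriv n z).continuousLinearMapAt ℝ y

theorem coeff_apply (hy : y ∈ (tangentTriv n z).baseSet) (v : TangentSpace (𝓡 n) y) :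
    coeff z y v = ((tangentTriv n z) ⟨y, v⟩).2 :=
  congrFun ((tangentTriv n z).coe_linearMapAt_of_mem (R := ℝ) hy) v

theorem constField_coeff (hy : y ∈ (tangentTriv n z).baseSet) (v : TangentSpace (𝓡 n) y) :
    constField z (coeff z y v) y = v :=
  (tangentTriv n z).symmL_continuousLinearMapAt hy v

theorem constField_add (z : M) (a b : 𝔼) :
    constField z (a + b) = constField z a + constField z b :=
  funext fun _ ↦ map_add _ a b

theorem constField_smul (z : M) (c : ℝ) (a : 𝔼) : constField z (c • a) = c • constField z a :=
  funext fun _ ↦ map_smul _ c a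

theorem contMDiffAt_constField (hy : y ∈ (tangentTriv n z).baseSet) (a : 𝔼) :
    ContMDiffAt (𝓡 n) (𝓡 n).tangent ∞
      (fun x ↦ (⟨x, constField z a x⟩ : TangentBundle (𝓡 n) M)) y := by
  rw [(tangentTriv n z).contMDiffAt_section_iff hy]
  refine (contMDiffAt_const (c := a)).congr_of_eventuallyEq ?_
  filter_upwards [baseSet_tangentTriv_mem_nhds hy] with x hx
  rw [constField, (tangentTriv n z).symmL_apply hx]
  exact congrArg Prod.snd ((tangentTriv n z).apply_mk_symm hx a)

theorem mdifferentiableAt_constField (hy : y ∈ (tangentTriv n z).baseSet) (a : 𝔼) :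
    MDifferentiableAt (𝓡 n) (𝓡 n).tangent
      (fun x ↦ (⟨x, constField z a x⟩ : TangentBundle (𝓡 n) M)) y :=
  (contMDiffAt_constField hy a).mdifferentiableAt (by simp)

theorem extend_eventuallyEq_constField (v : TangentSpace (𝓡 n) y) :
    ∀ᶠ x in 𝓝 y, (FiberBundle.extend 𝔼 v : ∀ x : M, TangentSpace (𝓡 n) x) x =
      constField y (coeff y y v) x := by
  have hy := mem_baseSet_tangentTriv_self (n := n) y
  filter_upwards [baseSet_tangentTriv_mem_nhds hy] with x hx
  rw [constField, (tangentTriv n y).symmL_apply hx, coeff_apply hy]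
  rfl

end TangentFrame

section ParallelForms

section

variable (n : ℕ) (M : Type*) [TopologicalSpace M] [ChartedSpace (EuclideanSpace ℝ (Fin n)) M]
  [IsManifold (𝓡 n) ∞ M]

/-- Fields of bilinear forms on the tangent spaces of `M`, with no regularity, symmetry or
nondegeneracy condition, so that they form a real vector space. -/
abbrev BilinFormField :=
  ∀ x : M, TangentSpace (𝓡 n) x →L[ℝ] TangentSpace (𝓡 n) x →L[ℝ] ℝ

end

variable {n : ℕ} {M : Type*} [TopologicalSpace M] [ChartedSpace (EuclideanSpace ℝ (Fin n)) M]

local notation "𝔼" => EuclideanSpace ℝ (Fin n)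

-- A shortcut: without it, the search for the module structure on `BilinFormField n M` times out.
instance continuousAdd_cotangentSpace (x : M) : ContinuousAdd (TangentSpace (𝓡 n) x →L[ℝ] ℝ) :=
  IsTopologicalAddGroup.toContinuousAdd

variable [IsManifold (𝓡 n) ∞ M]

/-- Smoothness of a field of bilinear forms, as a section of the bundle of bilinear forms. -/
def BilinFormField.IsSmooth (b : BilinFormField n M) : Prop :=
  ContMDiff (𝓡 n) ((𝓡 n).prod 𝓘(ℝ, 𝔼 →L[ℝ] 𝔼 →L[ℝ] ℝ)) ∞
    (fun x ↦ TotalSpace.mk' (𝔼 →L[ℝ] 𝔼 →L[ℝ] ℝ)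
      (E := fun x : M ↦ TangentSpace (𝓡 n) x →L[ℝ] TangentSpace (𝓡 n) x →L[ℝ] ℝ) x (b x))

theorem BilinFormField.IsSmooth.mdifferentiableAt_apply {b : BilinFormField n M}
    (hb : b.IsSmooth) {x : M} {Y Z : ∀ y : M, TangentSpace (𝓡 n) y}
    (hY : MDifferentiableAt (𝓡 n) (𝓡 n).tangent
      (fun y ↦ (⟨y, Y y⟩ : TangentBundle (𝓡 n) M)) x)
    (hZ : MDifferentiableAt (𝓡 n) (𝓡 n).tangent
      (fun y ↦ (⟨y, Z y⟩ : TangentBundle (𝓡 n) M)) x) :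
    MDifferentiableAt (𝓡 n) 𝓘(ℝ, ℝ) (fun y ↦ b y (Y y) (Z y)) x := by
  have h := MDifferentiableAt.clm_bundle_apply₂ (F₁ := 𝔼) (F₂ := 𝔼) (F₃ := ℝ)
    (E₃ := Bundle.Trivial M ℝ) (b := id) ((hb x).mdifferentiableAt (by simp)) hY hZ
  simp only [mdifferentiableAt_totalSpace] at h
  exact h.2

/-- The space of smooth fields `b` of bilinear forms with `∇ b = 0`. -/
def LinearConnection.parallelForms (D : LinearConnection n M) :
    Submodule ℝ (BilinFormField n M) where
  carrier := {b | b.IsSmooth ∧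
    ∀ (x : M) (X : TangentSpace (𝓡 n) x) (Y Z : ∀ y : M, TangentSpace (𝓡 n) y),
      MDifferentiableAt (𝓡 n) (𝓡 n).tangent (fun y ↦ (⟨y, Y y⟩ : TangentBundle (𝓡 n) M)) x →
      MDifferentiableAt (𝓡 n) (𝓡 n).tangent (fun y ↦ (⟨y, Z y⟩ : TangentBundle (𝓡 n) M)) x →
        mvfderiv (𝓡 n) (fun y ↦ b y (Y y) (Z y)) x X =
          b x (D.cov Y x X) (Z x) + b x (Y x) (D.cov Z x X)}
  add_mem' {b b'} hb hb' := by
    refine ⟨ContMDiff.add_section hb.1 hb'.1, fun x X Y Z hY hZ ↦ ?_⟩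
    have h := mvfderiv_fun_add (hb.1.mdifferentiableAt_apply hY hZ)
      (hb'.1.mdifferentiableAt_apply hY hZ)
    exact (congrArg (· X) h).trans ((congrArg₂ (· + ·) (hb.2 x X Y Z hY hZ)
      (hb'.2 x X Y Z hY hZ)).trans (add_add_add_comm _ _ _ _))
  zero_mem' := ⟨contMDiff_zeroSection ℝ (F := 𝔼 →L[ℝ] 𝔼 →L[ℝ] ℝ)
    (fun x : M ↦ TangentSpace (𝓡 n) x →L[ℝ] TangentSpace (𝓡 n) x →L[ℝ] ℝ), fun x X _ _ _ _ ↦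
    (congrArg (· X) (mvfderiv_const (I := 𝓡 n) (F := ℝ) 0 (x := x))).trans (add_zero 0).symm⟩
  smul_mem' c b hb := by
    refine ⟨ContMDiff.const_smul_section hb.1, fun x X Y Z hY hZ ↦ ?_⟩
    have h := mvfderiv_fun_smul (mdifferentiableAt_const (c := c))
      (hb.1.mdifferentiableAt_apply hY hZ)
    rw [mvfderiv_const, ContinuousLinearMap.zero_smulRight, add_zero] at h
    exact (congrArg (· X) h).trans
      ((congrArg (c • ·) (hb.2 x X Y Z hY hZ)).trans (smul_add _ _ _))

theorem SemiRiemannianMetric.IsParallel.mem_parallelForms {g : SemiRiemannianMetric n M}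
    {D : LinearConnection n M} (h : g.IsParallel D) : g.toFun ∈ D.parallelForms :=
  ⟨g.smooth, h⟩

end ParallelForms

section LocalForm

variable {n : ℕ} {M : Type*} [TopologicalSpace M] [ChartedSpace (EuclideanSpace ℝ (Fin n)) M]
  [IsManifold (𝓡 n) ∞ M] {b : BilinFormField n M} {D : LinearConnection n M} {z y : M}

local notation "𝔼" => EuclideanSpace ℝ (Fin n)

/-- The matrix of a field of bilinear forms in the coordinate frame of the chart at `z`. -/
def BilinFormField.localForm (b : BilinFormField n M) (z y : M) : 𝔼 →L[ℝ] 𝔼 →L[ℝ] ℝ :=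
  ((tangentTriv n z).symmL ℝ y).precomp ℝ ∘L b y ∘L (tangentTriv n z).symmL ℝ y

theorem localForm_apply (b : BilinFormField n M) (z y : M) (v w : 𝔼) :
    b.localForm z y v w = b y (constField z v y) (constField z w y) :=
  rfl

theorem apply_eq_localForm (b : BilinFormField n M) (hy : y ∈ (tangentTriv n z).baseSet)
    (v w : TangentSpace (𝓡 n) y) :
    b y v w = b.localForm z y (coeff z y v) (coeff z y w) := by
  rw [localForm_apply, constField_coeff hy, constField_coeff hy]

theorem localForm_eq_zero_iff (hy : y ∈ (tangentTriv n z).baseSet) :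
    b.localForm z y = 0 ↔ b y = 0 := by
  constructor
  · intro h
    ext v w
    rw [apply_eq_localForm b hy, h]
    rfl
  · intro h
    ext v w : 2
    rw [localForm_apply, h]
    rfl

theorem BilinFormField.IsSmooth.contMDiffAt_localForm (hb : b.IsSmooth)
    (hy : y ∈ (tangentTriv n z).baseSet) :
    ContMDiffAt (𝓡 n) 𝓘(ℝ, 𝔼 →L[ℝ] 𝔼 →L[ℝ] ℝ) ∞ (b.localForm z) y := by
  refine contMDiffAt_clm_of_apply fun v ↦ contMDiffAt_clm_of_apply fun w ↦ ?_
  have h := ContMDiffAt.clm_bundle_apply₂ (F₁ := 𝔼) (F₂ := 𝔼) (F₃ := ℝ)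
    (E₃ := Bundle.Trivial M ℝ) (b := id) (hb y) (contMDiffAt_constField hy v)
    (contMDiffAt_constField hy w)
  simp only [contMDiffAt_totalSpace] at h
  exact h.2

theorem mdifferentiableAt_localForm (hb : b ∈ D.parallelForms)
    (hy : y ∈ (tangentTriv n z).baseSet) :
    MDifferentiableAt (𝓡 n) 𝓘(ℝ, 𝔼 →L[ℝ] 𝔼 →L[ℝ] ℝ) (b.localForm z) y :=
  (hb.1.contMDiffAt_localForm hy).mdifferentiableAt (by simp)

theorem mvfderiv_localForm (hb : b ∈ D.parallelForms) (hy : y ∈ (tangentTriv n z).baseSet)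
    (X : TangentSpace (𝓡 n) y) (v w : 𝔼) :
    mvfderiv (𝓡 n) (b.localForm z) y X v w =
      b.localForm z y (coeff z y (D.cov (constField z v) y X)) w +
        b.localForm z y v (coeff z y (D.cov (constField z w) y X)) := by
  rw [localForm_apply, localForm_apply, constField_coeff hy, constField_coeff hy,
    ← hb.2 y X _ _ (mdifferentiableAt_constField hy v) (mdifferentiableAt_constField hy w)]
  exact (mvfderiv_clm_apply_const₂ (mdifferentiableAt_localForm hb hy) v w X).symm

end LocalForm

section Holonomy

variable {n : ℕ} {M : Type*} [TopologicalSpace M] [ChartedSpace (EuclideanSpace ℝ (Fin n)) M]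
  [IsManifold (𝓡 n) ∞ M] {b : BilinFormField n M} {D : LinearConnection n M}

local notation "𝔼" => EuclideanSpace ℝ (Fin n)

theorem LinearConnection.cov_extend (D : LinearConnection n M) {x : M}
    (v : TangentSpace (𝓡 n) x) :
    D.cov (FiberBundle.extend 𝔼 v) x = D.cov (constField x (coeff x x v)) x :=
  D.cov.isCovariantDerivativeOnUniv.congr_of_eventuallyEq
    (FiberBundle.mdifferentiableAt_extend (𝓡 n) _ v)
    (mdifferentiableAt_constField (mem_baseSet_tangentTriv_self x) _) Filter.univ_mem
    (extend_eventuallyEq_constField v)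

variable {γ : ℝ → M} {s : Set ℝ} {t : ℝ} {V W : ∀ u : ℝ, TangentSpace (𝓡 n) (γ u)}

theorem LinearConnection.HasCovDerivAlongWithinAt.hasDerivWithinAt_coeff
    (hV : D.HasCovDerivAlongWithinAt γ V s t 0) :
    HasDerivWithinAt (fun u ↦ ((tangentTriv n (γ t)) ⟨γ u, V u⟩).2)
      (-coeff (γ t) (γ t) (D.cov (constField (γ t) (coeff (γ t) (γ t) (V t))) (γ t)
        (mfderivWithin 𝓘(ℝ) (𝓡 n) γ s t (1 : ℝ)))) s t := by
  refine HasDerivWithinAt.congr_deriv hV ?_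
  rw [← coeff_apply (mem_baseSet_tangentTriv_self (γ t)), D.cov_extend, zero_sub, map_neg]

theorem hasDerivWithinAt_parallelForm_along (hb : b ∈ D.parallelForms) (ht : t ∈ s)
    (hγ : MDifferentiableWithinAt 𝓘(ℝ) (𝓡 n) γ s t)
    (hV : D.HasCovDerivAlongWithinAt γ V s t 0) (hW : D.HasCovDerivAlongWithinAt γ W s t 0) :
    HasDerivWithinAt (fun u ↦ b (γ u) (V u) (W u)) 0 s t := by
  have hx := mem_baseSet_tangentTriv_self (n := n) (γ t)
  have hform := hasDerivWithinAt_comp_of_mdifferentiableAt (mdifferentiableAt_localForm hb hx)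
    hγ.hasMFDerivWithinAt
  have hcoord : (fun u ↦ b (γ u) (V u) (W u)) =ᶠ[𝓝[s] t] fun u ↦ b.localForm (γ t) (γ u)
      ((tangentTriv n (γ t)) ⟨γ u, V u⟩).2 ((tangentTriv n (γ t)) ⟨γ u, W u⟩).2 := by
    filter_upwards [hγ.continuousWithinAt.preimage_mem_nhdsWithin
      (baseSet_tangentTriv_mem_nhds hx)] with u hu
    rw [apply_eq_localForm b hu, coeff_apply hu, coeff_apply hu]
  refine (hasDerivWithinAt_bilin_apply_eq_zero hform hV.hasDerivWithinAt_coeff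
    hW.hasDerivWithinAt_coeff ?_).congr_of_eventuallyEq_of_mem hcoord ht
  rw [← coeff_apply hx, ← coeff_apply hx]
  exact mvfderiv_localForm hb hx _ _ _

theorem parallelForm_apply_of_isParallelTranslationAlong (hb : b ∈ D.parallelForms) {x y : M}
    {τ : TangentSpace (𝓡 n) x ≃ₗ[ℝ] TangentSpace (𝓡 n) y}
    (hτ : D.IsParallelTranslationAlong γ x y τ) (v w : TangentSpace (𝓡 n) x) :
    b y (τ v) (τ w) = b x v w := by
  obtain ⟨hγ, rfl, rfl, hτ⟩ := hτ
  obtain ⟨V, hV, hV0, hV1⟩ := hτ v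
  obtain ⟨W, hW, hW0, hW1⟩ := hτ w
  rw [← TotalSpace.mk_inj.1 hV1, ← TotalSpace.mk_inj.1 hW1, ← TotalSpace.mk_inj.1 hV0,
    ← TotalSpace.mk_inj.1 hW0]
  have hd (t : ℝ) (ht : t ∈ Icc (0 : ℝ) 1) :=
    hasDerivWithinAt_parallelForm_along hb ht (hγ.mdifferentiableOn one_ne_zero t ht) (hV t ht)
      (hW t ht)
  refine constant_of_derivWithin_zero (fun t ht ↦ (hd t ht).differentiableWithinAt)
    (fun t ht ↦ ?_) 1 (right_mem_Icc.2 zero_le_one)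
  have ht := Ico_subset_Icc_self ht
  exact (hd t ht).derivWithin (uniqueDiffOn_Icc_zero_one t ht)

theorem parallelForm_apply_of_isParallelTranslation (hb : b ∈ D.parallelForms) {x y : M}
    {τ : TangentSpace (𝓡 n) x ≃ₗ[ℝ] TangentSpace (𝓡 n) y}
    (hτ : D.IsParallelTranslation x y τ) (v w : TangentSpace (𝓡 n) x) :
    b y (τ v) (τ w) = b x v w := by
  induction hτ with
  | of_curve γ hγ => exact parallelForm_apply_of_isParallelTranslationAlong hb hγ v w
  | concat _ _ ih ih' => exact (ih' _ _).trans (ih v w)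

end Holonomy

section Extension

variable {E H M F : Type*} [NormedAddCommGroup E] [NormedSpace ℝ E] [FiniteDimensional ℝ E]
  [TopologicalSpace H] {I : ModelWithCorners ℝ E H} [TopologicalSpace M] [ChartedSpace H M]
  [IsManifold I ∞ M] [T2Space M] [NormedAddCommGroup F] [NormedSpace ℝ F] {V : M → Type*}
  [TopologicalSpace (TotalSpace F V)] [∀ x, AddCommGroup (V x)] [∀ x, Module ℝ (V x)]
  [∀ x, TopologicalSpace (V x)] [FiberBundle F V] [VectorBundle ℝ F V]

theorem exists_contMDiff_eventuallyEq {σ : ∀ x, V x} {u : Set M} {y : M} (hu : IsOpen u)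
    (hy : y ∈ u) (hσ : ContMDiffOn I (I.prod 𝓘(ℝ, F)) ∞ (fun x ↦ TotalSpace.mk' F x (σ x)) u) :
    ∃ σ' : ∀ x, V x, ContMDiff I (I.prod 𝓘(ℝ, F)) ∞ (fun x ↦ TotalSpace.mk' F x (σ' x)) ∧
      ∀ᶠ x in 𝓝 y, σ' x = σ x := by
  obtain ⟨f, -, hf⟩ := (SmoothBumpFunction.nhds_basis_tsupport (I := I) y).mem_iff.1
    (hu.mem_nhds hy)
  refine ⟨fun x ↦ f x • σ x,
    ContMDiffOn.smul_section_of_tsupport f.contMDiff.contMDiffOn hu hf hσ, ?_⟩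
  filter_upwards [f.eventuallyEq_one] with x hx
  rw [hx, Pi.one_apply, one_smul]

end Extension

section Christoffel

variable {n : ℕ} {M : Type*} [TopologicalSpace M] [ChartedSpace (EuclideanSpace ℝ (Fin n)) M]
  [IsManifold (𝓡 n) ∞ M] {D : LinearConnection n M} {z y : M}

local notation "𝔼" => EuclideanSpace ℝ (Fin n)

theorem LinearConnection.contMDiffAt_cov_constField [T2Space M] (D : LinearConnection n M)
    (hy : y ∈ (tangentTriv n z).baseSet) (a : 𝔼) :
    ContMDiffAt (𝓡 n) ((𝓡 n).prod 𝓘(ℝ, 𝔼 →L[ℝ] 𝔼)) ∞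
      (fun x ↦ TotalSpace.mk' (𝔼 →L[ℝ] 𝔼)
        (E := fun x : M ↦ TangentSpace (𝓡 n) x →L[ℝ] TangentSpace (𝓡 n) x) x
        (D.cov (constField z a) x)) y := by
  obtain ⟨σ, hσ, heq⟩ := exists_contMDiff_eventuallyEq (tangentTriv n z).open_baseSet hy
    fun x hx ↦ (contMDiffAt_constField hx a).contMDiffWithinAt
  have hcov := D.smooth.contMDiff.contMDiff (σ := σ) hσ.contMDiffOn y (mem_univ y)
  refine (hcov.contMDiffAt Filter.univ_mem).congr_of_eventuallyEq ?_
  filter_upwards [heq.eventually_nhds, baseSet_tangentTriv_mem_nhds hy] with x hx hxb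
  refine congrArg (TotalSpace.mk x) ?_
  exact (D.cov.isCovariantDerivativeOnUniv.congr_of_eventuallyEq
    ((hσ x).mdifferentiableAt (by simp)) (mdifferentiableAt_constField hxb a)
    Filter.univ_mem hx).symm

theorem LinearConnection.continuousAt_coeff_cov_constField [T2Space M] (D : LinearConnection n M)
    (hy : y ∈ (tangentTriv n z).baseSet) (a ξ : 𝔼) :
    ContinuousAt (fun x ↦ coeff z x (D.cov (constField z a) x (constField z ξ x))) y := by
  have h := (D.contMDiffAt_cov_constField hy a).clm_bundle_apply
    (E₁ := fun x : M ↦ TangentSpace (𝓡 n) x) (E₂ := fun x : M ↦ TangentSpace (𝓡 n) x) (b := id)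
    (contMDiffAt_constField hy ξ)
  refine (((tangentTriv n z).contMDiffAt_section_iff hy).1 h).continuousAt.congr ?_
  filter_upwards [baseSet_tangentTriv_mem_nhds hy] with x hx
  exact (coeff_apply hx _).symm

/-- The matrix of `a ↦ ∇_ξ a` in the frame of the chart at `z`, where `ξ` and `a` are extended with
constant coefficients: the contraction of the Christoffel symbols with `ξ`. -/
def LinearConnection.christoffel (D : LinearConnection n M) (z : M) (ξ : 𝔼) (y : M) : 𝔼 →L[ℝ] 𝔼 :=
  LinearMap.toContinuousLinearMap <| (EuclideanSpace.basisFun (Fin n) ℝ).toBasis.constr ℝ fun i ↦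
    coeff z y (D.cov (constField z (EuclideanSpace.basisFun (Fin n) ℝ i)) y (constField z ξ y))

theorem LinearConnection.christoffel_apply (D : LinearConnection n M)
    (hy : y ∈ (tangentTriv n z).baseSet) (ξ a : 𝔼) :
    D.christoffel z ξ y a = coeff z y (D.cov (constField z a) y (constField z ξ y)) := by
  let L : 𝔼 →ₗ[ℝ] 𝔼 :=
    { toFun := fun a ↦ coeff z y (D.cov (constField z a) y (constField z ξ y))
      map_add' := fun a b ↦ by
        rw [constField_add, D.cov.isCovariantDerivativeOnUniv.add
          (mdifferentiableAt_constField hy a) (mdifferentiableAt_constField hy b), add_apply,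
          map_add]
      map_smul' := fun c a ↦ by
        rw [constField_smul, D.cov.isCovariantDerivativeOnUniv.smul_const c
          (mdifferentiableAt_constField hy a), smul_apply, map_smul, RingHom.id_apply] }
  exact LinearMap.congr_fun (Module.Basis.constr_eq (f := L) _ ℝ fun i ↦ by
    rw [OrthonormalBasis.coe_toBasis]; rfl) a

theorem LinearConnection.continuousOn_christoffel [T2Space M] (D : LinearConnection n M) (z : M)
    (ξ : 𝔼) : ContinuousOn (D.christoffel z ξ) (tangentTriv n z).baseSet :=
  continuousOn_clm_apply.2 fun a _ hy ↦ ((D.continuousAt_coeff_cov_constField hy a ξ).congr <|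
    Filter.eventually_of_mem (baseSet_tangentTriv_mem_nhds hy) fun _ hx ↦
      (D.christoffel_apply hx ξ a).symm).continuousWithinAt

end Christoffel

section Propagation

open AffineMap

variable {n : ℕ} {M : Type*} [TopologicalSpace M] [ChartedSpace (EuclideanSpace ℝ (Fin n)) M]
  [IsManifold (𝓡 n) ∞ M] {b : BilinFormField n M} {D : LinearConnection n M} {z : M}

local notation "𝔼" => EuclideanSpace ℝ (Fin n)

theorem hasMFDerivWithinAt_extChartAt_symm_lineMap {p q : 𝔼} {s : Set ℝ} {t : ℝ}
    (ht : lineMap p q t ∈ (extChartAt (𝓡 n) z).target) :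
    HasMFDerivWithinAt 𝓘(ℝ) (𝓡 n) (fun u ↦ (extChartAt (𝓡 n) z).symm (lineMap p q u)) s t
      (ContinuousLinearMap.toSpanSingleton ℝ
        (constField z (q - p) ((extChartAt (𝓡 n) z).symm (lineMap p q t)))) := by
  have hsymm := (mdifferentiableWithinAt_extChartAt_symm (I := 𝓡 n) ht).hasMFDerivWithinAt
  have hline : HasDerivWithinAt (lineMap p q) (q - p) s t := hasDerivWithinAt_lineMap
  have hsource := (extChartAt (𝓡 n) z).map_target ht
  rw [extChartAt_source] at hsource
  have hframe := TangentBundle.symmL_trivializationAt (I := 𝓡 n) hsource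
  rw [(extChartAt (𝓡 n) z).right_inv ht] at hframe
  rw [constField, hframe]
  exact (hsymm.comp t hline.hasFDerivWithinAt.hasMFDerivWithinAt fun _ _ ↦ by simp).congr_mfderiv
    (ContinuousLinearMap.ext fun c : ℝ ↦ (mfderivWithin _ _ _ _ _).map_smul c (q - p))

theorem localForm_eq_zero_of_segment_subset [T2Space M] (hb : b ∈ D.parallelForms) {p q : 𝔼}
    (hpq : segment ℝ p q ⊆ (extChartAt (𝓡 n) z).target)
    (hp : b.localForm z ((extChartAt (𝓡 n) z).symm p) = 0) :
    b.localForm z ((extChartAt (𝓡 n) z).symm q) = 0 := by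
  let γ (t : ℝ) : M := (extChartAt (𝓡 n) z).symm (lineMap p q t)
  have htarget (t : ℝ) (ht : t ∈ Icc (0 : ℝ) 1) : lineMap p q t ∈ (extChartAt (𝓡 n) z).target :=
    hpq (segment_eq_image_lineMap ℝ p q ▸ mem_image_of_mem _ ht)
  have hbase : MapsTo γ (Icc 0 1) (tangentTriv n z).baseSet := fun t ht ↦
    mem_baseSet_tangentTriv_iff.2 ((extChartAt (𝓡 n) z).map_target (htarget t ht))
  have hγ (t : ℝ) (ht : t ∈ Icc (0 : ℝ) 1) :=
    hasMFDerivWithinAt_extChartAt_symm_lineMap (s := Icc 0 1) (htarget t ht)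
  have hu (t : ℝ) (ht : t ∈ Icc (0 : ℝ) 1) := hasDerivWithinAt_comp_of_mdifferentiableAt
    (mdifferentiableAt_localForm hb (hbase ht)) (hγ t ht)
  have hA : ContinuousOn (fun t ↦ D.christoffel z (q - p) (γ t)) (Icc 0 1) :=
    (D.continuousOn_christoffel z (q - p)).comp (fun t ht ↦ (hγ t ht).continuousWithinAt) hbase
  have h := bilin_eq_zero_of_hasDerivWithinAt (F := 𝔼) hA hu
    (fun t ht v w ↦ by
      rw [D.christoffel_apply (hbase ht), D.christoffel_apply (hbase ht),
        ContinuousLinearMap.toSpanSingleton_apply, one_smul]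
      exact mvfderiv_localForm hb (hbase ht) _ v w)
    (by simpa [γ] using hp)
  simpa [γ] using h

theorem eventually_eq_zero_iff_of_mem_parallelForms [T2Space M] (hb : b ∈ D.parallelForms)
    (z : M) : ∀ᶠ y in 𝓝 z, b y = 0 ↔ b z = 0 := by
  obtain ⟨r, hr, hball⟩ := Metric.isOpen_iff.1 (isOpen_extChartAt_target (I := 𝓡 n) z)
    (extChartAt (𝓡 n) z z) (mem_extChartAt_target z)
  have hpropagate {x y : M} (hx : x ∈ (extChartAt (𝓡 n) z).source)
      (hy : y ∈ (extChartAt (𝓡 n) z).source)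
      (hxr : extChartAt (𝓡 n) z x ∈ Metric.ball (extChartAt (𝓡 n) z z) r)
      (hyr : extChartAt (𝓡 n) z y ∈ Metric.ball (extChartAt (𝓡 n) z z) r) (h : b x = 0) :
      b y = 0 := by
    rw [← localForm_eq_zero_iff (mem_baseSet_tangentTriv_iff.2 hy),
      ← (extChartAt (𝓡 n) z).left_inv hy]
    refine localForm_eq_zero_of_segment_subset hb
      (((convex_ball _ r).segment_subset hxr hyr).trans hball) ?_
    rwa [(extChartAt (𝓡 n) z).left_inv hx,
      localForm_eq_zero_iff (mem_baseSet_tangentTriv_iff.2 hx)]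
  filter_upwards [(continuousAt_extChartAt (I := 𝓡 n) z).preimage_mem_nhds
    (Metric.ball_mem_nhds _ hr), extChartAt_source_mem_nhds (I := 𝓡 n) z] with y hyr hy
  exact ⟨hpropagate hy (mem_extChartAt_source z) hyr (Metric.mem_ball_self hr),
    hpropagate (mem_extChartAt_source z) hy (Metric.mem_ball_self hr) hyr⟩

theorem eq_zero_of_mem_parallelForms [T2Space M] [PreconnectedSpace M] (hb : b ∈ D.parallelForms)
    {x : M} (hx : b x = 0) : b = 0 := by
  have hloc : IsLocallyConstant fun y ↦ b y = 0 := (IsLocallyConstant.iff_eventually_eq _).2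
    fun z ↦ (eventually_eq_zero_iff_of_mem_parallelForms hb z).mono fun _ ↦ propext
  exact funext fun y ↦ (hloc.apply_eq_of_preconnectedSpace x y).mp hx

end Propagation

section ParallelMetrics

variable {n : ℕ} {M : Type*} [TopologicalSpace M] [ChartedSpace (EuclideanSpace ℝ (Fin n)) M]

instance finiteDimensional_tangentSpace (x : M) : FiniteDimensional ℝ (TangentSpace (𝓡 n) x) :=
  inferInstanceAs (FiniteDimensional ℝ (EuclideanSpace ℝ (Fin n)))

theorem finrank_tangentSpace (x : M) : Module.finrank ℝ (TangentSpace (𝓡 n) x) = n :=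
  finrank_euclideanSpace_fin

variable [IsManifold (𝓡 n) ∞ M]

namespace SemiRiemannianMetric

/-- The metric at a point, as an algebraic bilinear form. -/
def bilinForm (g : SemiRiemannianMetric n M) (x : M) :
    LinearMap.BilinForm ℝ (TangentSpace (𝓡 n) x) :=
  (g.toFun x).toLinearMap₁₂

theorem nondegenerate_bilinForm (g : SemiRiemannianMetric n M) (x : M) :
    (g.bilinForm x).Nondegenerate :=
  ⟨g.nondegenerate x, fun w hw ↦ g.nondegenerate x w fun v ↦ (g.symm x w v).trans (hw v)⟩

theorem IsParallel.bilinForm_mem_invariantSymmForms {g : SemiRiemannianMetric n M}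
    {D : LinearConnection n M} (hg : g.IsParallel D) (x : M) :
    g.bilinForm x ∈ invariantSymmForms (D.holonomyGroup x) :=
  ⟨g.symm x, fun _ hψ ↦ parallelForm_apply_of_isParallelTranslation hg.mem_parallelForms hψ⟩

end SemiRiemannianMetric

namespace LinearConnection.AreIndependentParallelMetrics

variable {D : LinearConnection n M} {k : ℕ} {g : Fin k → SemiRiemannianMetric n M}

theorem bilinForm_mem (hg : D.AreIndependentParallelMetrics g) (i : Fin k) (x : M) :
    (g i).bilinForm x ∈ invariantSymmForms (D.holonomyGroup x) :=
  (hg.2 i).bilinForm_mem_invariantSymmForms x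

variable [T2Space M] [PreconnectedSpace M]

theorem linearIndependent_bilinForm (hg : D.AreIndependentParallelMetrics g) (x : M) :
    LinearIndependent ℝ fun i ↦ (g i).bilinForm x := by
  refine linearIndependent_bilinForm_iff.2 fun c hc ↦ hg.1 c ?_
  let B : BilinFormField n M := ∑ i, c i • (g i).toFun
  have hB : B ∈ D.parallelForms :=
    Submodule.sum_mem _ fun i _ ↦ Submodule.smul_mem _ (c i) (hg.2 i).mem_parallelForms
  have hB_apply (y : M) (v w : TangentSpace (𝓡 n) y) :
      B y v w = ∑ i, c i * (g i).toFun y v w := by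
    simp only [B, Finset.sum_apply, Pi.smul_apply, sum_apply, smul_apply, smul_eq_mul]
  have hBx : B x = 0 := by
    ext v w
    exact (hB_apply x v w).trans (hc v w)
  intro y v w
  rw [← hB_apply, eq_zero_of_mem_parallelForms hB hBx]
  rfl

theorem le_finrank_invariantSymmForms (hg : D.AreIndependentParallelMetrics g) (x : M) :
    k ≤ Module.finrank ℝ (invariantSymmForms (D.holonomyGroup x)) := by
  have h : LinearIndependent ℝ fun i ↦
      (⟨(g i).bilinForm x, hg.bilinForm_mem i x⟩ : invariantSymmForms (D.holonomyGroup x)) :=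
    .of_comp (Submodule.subtype _) (hg.linearIndependent_bilinForm x)
  simpa using h.fintype_card_le_finrank

end LinearConnection.AreIndependentParallelMetrics

end ParallelMetrics

end

theorem theorem1 {n : ℕ} {M : Type*} [TopologicalSpace M] [T2Space M] [ConnectedSpace M]
    [ChartedSpace (EuclideanSpace ℝ (Fin n)) M] [IsManifold (𝓡 n) ∞ M]
    (D : LinearConnection n M) :
    (∀ g : Fin 2 → SemiRiemannianMetric n M, D.AreIndependentParallelMetrics g →
      (∃ i p q, p ≠ q ∧ (g i).HasSignature p q) → D.HasReducibleHolonomy) ∧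
    (n = 2 → ∀ g : Fin 2 → SemiRiemannianMetric n M, D.AreIndependentParallelMetrics g →
      D.HasReducibleHolonomy) ∧
    (¬ n ≡ 0 [MOD 4] → ∀ g : Fin 3 → SemiRiemannianMetric n M,
      D.AreIndependentParallelMetrics g → D.HasReducibleHolonomy) ∧
    (∀ g : Fin 4 → SemiRiemannianMetric n M, D.AreIndependentParallelMetrics g →
      D.HasReducibleHolonomy) := by
  refine ⟨fun g hg ⟨i, p, q, hpq, hsig⟩ x ↦ ?_, fun hn g hg x ↦ ?_, fun hn g hg x ↦ ?_,
    fun g hg x ↦ ?_⟩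
  · obtain ⟨hp, hq⟩ := hsig x
    exact actsReducibly_of_sigPos_ne_sigNeg ((g i).nondegenerate_bilinForm x)
      (hg.bilinForm_mem i x) (fun h ↦ hpq (hp.symm.trans (h.trans hq)))
      (hg.le_finrank_invariantSymmForms x)
  · exact actsReducibly_of_one_lt_finrank_invariantSymmForms ((finrank_tangentSpace x).trans hn)
      ((g 0).nondegenerate_bilinForm x) (hg.bilinForm_mem 0 x) (hg.le_finrank_invariantSymmForms x)
  · have hdvd : ¬ 4 ∣ Module.finrank ℝ (TangentSpace (𝓡 n) x) := by
      rwa [finrank_tangentSpace, ← Nat.modEq_zero_iff_dvd]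
    exact actsReducibly_of_two_lt_finrank_invariantSymmForms hdvd
      ((g 0).nondegenerate_bilinForm x) (hg.bilinForm_mem 0 x) (hg.le_finrank_invariantSymmForms x)
  · exact actsReducibly_of_three_lt_finrank_invariantSymmForms
      ((g 0).nondegenerate_bilinForm x) (hg.bilinForm_mem 0 x) (hg.le_finrank_invariantSymmForms x)
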